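/- Let $\ell^2(\{\#\}\cup\mathbb N)$ have canonical orthonormal basis $e_\#,e_0,e_1,\dots$ and matrix units $\varepsilon_{mn}=\langle\,\cdot\,,e_n\rangle e_m$. Let $\mathfrak b=\mathcal K(\ell^2(\{\#\}\cup\mathbb N))+\mathbb C I$ be the Boolean algebra (compact operators plus scalars), let $\mathfrak A=\mathbb M_2(\mathbb C)\oplus\mathbb C$, and for $j\in\mathbb N$ let $\iota_j:\mathfrak A\to\mathfrak b$ be the unital embedding $$\iota_j\left(\begin{pmatrix}a&b\\c&d\end{pmatrix}\oplus\beta\right)=a\,\varepsilon_{\#\#}+b\,\varepsilon_{\#j}+c\,\varepsilon_{j\#}+d\,\varepsilon_{jj}+\beta P_{\mathbb N\setminus\{j\}},$$ where $P_{\mathbb N\setminus\{j\}}$ is the orthogonal projection onto $\ell^2(\mathbb N\setminus\{j\})$. Let $\omega$ be a state on $\mathfrak b$ with Gelfand–Naimark–Segal triple $(\mathcal H,\pi,\Omega)$. The Boolean process given by $\omega$ is $(\mathfrak A,\mathcal H,\{\pi\circ\iota_j\}_{j\in\mathbb N},\Omega)$. Write $\hat\iota_j=\pi\circ\iota_j$,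 let $\bigvee$ denote the generated von Neumann algebra on $\mathcal H$ (with unit $I$), and put $M=\bigvee_{j\in\mathbb N}\hat\iota_j(\mathfrak A)$. The process is *exchangeable* if for every permutation $g$ of $\mathbb N$ moving only finitely many indices, all $n$, all $j_1,\dots,j_n\in\mathbb N$ and all $A_1,\dots,A_n\in\mathfrak A$, $$\langle\hat\iota_{j_1}(A_1)\cdots\hat\iota_{j_n}(A_n)\Omega,\Omega\rangle=\langle\hat\iota_{g(j_1)}(A_1)\cdots\hat\iota_{g(j_n)}(A_n)\Omega,\Omega\rangle .$$ Its *tail algebra* is $$\mathfrak Z^\perp=\bigcap_{I\subset\mathbb N\text{ finite}}\Big(\bigcup_{K\text{ finite},\,K\cap I=\emptyset}\ \bigvee_{k\in K}\hat\iota_k(\mathfrak A)\Big)''\subset M .$$ The process is *(conditionally) independent and identically distributed with respect to the tail algebra* if there is a conditional expectation $E:M\to\mathfrak Z^\perp$ (a positive linear projection onto $\mathfrak Z^\perp$ satisfying the $\mathfrak Z^\perp$-bimodule property, not necessarily normal) which preserves the vector state $\langle\,\cdot\,\Omega,\Omega\rangle$ and satisfies (i) $\langle XY\Omega,\Omega\rangle=\langle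 E(X)E(Y)\Omega,\Omega\rangle$ for all finite disjoint $I,K\subset\mathbb N$, all $X\in\big(\bigvee_{i\in I}\hat\iota_i(\mathfrak A)\big)\vee\mathfrak Z^\perp$ and all $Y\in\big(\bigvee_{k\in K}\hat\iota_k(\mathfrak A)\big)\vee\mathfrak Z^\perp$; (ii) $E(\hat\iota_i(A))=E(\hat\iota_k(A))$ for all $i,k\in\mathbb N$ and $A\in\mathfrak A$. **Theorem.** For every state $\omega$ on $\mathfrak b$, the Boolean process given by $\omega$ is exchangeable if and only if it is independent and identically distributed with respect to its tail algebra. -/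

import Mathlib

open scoped ComplexOrder

noncomputable section

namespace BooleanDeFinetti

/-! ### Von Neumann algebras generated by sets of operators, conditional expectations -/

section VonNeumann

variable {H : Type*} [NormedAddCommGroup H] [InnerProductSpace ℂ H] [CompleteSpace H]

/-- The von Neumann algebra generated by a set `S` of bounded operators, that is the double
commutant of `S ∪ S*`. For a selfadjoint set this is `S''`. -/
def vonNeumannGen (S : Set (H →L[ℂ] H)) : StarSubalgebra ℂ (H →L[ℂ] H) :=
  StarSubalgebra.centralizer ℂ (StarSubalgebra.centralizer ℂ S : Set (H →L[ℂ] H))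

theorem subset_vonNeumannGen (S : Set (H →L[ℂ] H)) : S ⊆ vonNeumannGen S := by
  intro x hx
  rw [SetLike.mem_coe, vonNeumannGen, StarSubalgebra.mem_centralizer_iff]
  intro g hg
  have hg' := star_mem hg
  rw [SetLike.mem_coe, StarSubalgebra.mem_centralizer_iff] at hg
  rw [StarSubalgebra.mem_centralizer_iff] at hg'
  exact ⟨(hg x hx).1.symm, (hg' x hx).1.symm⟩

theorem vonNeumannGen_mono {S T : Set (H →L[ℂ] H)} (h : S ⊆ T) :
    vonNeumannGen S ≤ vonNeumannGen T :=
  StarSubalgebra.centralizer_le ℂ _ _ (StarSubalgebra.centralizer_le ℂ _ _ h)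

theorem vonNeumannGen_le {S T : Set (H →L[ℂ] H)} (h : S ⊆ vonNeumannGen T) :
    vonNeumannGen S ≤ vonNeumannGen T := by
  apply StarSubalgebra.centralizer_le
  intro x hx
  rw [SetLike.mem_coe, StarSubalgebra.mem_centralizer_iff]
  intro g hg
  have h1 := h hg
  rw [SetLike.mem_coe, vonNeumannGen, StarSubalgebra.mem_centralizer_iff] at h1
  have h2 := star_mem (h hg)
  rw [vonNeumannGen, StarSubalgebra.mem_centralizer_iff] at h2
  exact ⟨(h1 x hx).1.symm, (h2 x hx).1.symm⟩

/-- `E : M → N` is a conditional expectation of the von Neumann algebra `M` onto its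
subalgebra `N`: a positive linear projection onto `N` with the bimodule property over `N`.
No normality is required. -/
structure IsConditionalExpectation {N M : StarSubalgebra ℂ (H →L[ℂ] H)} (h : N ≤ M)
    (E : M →ₗ[ℂ] N) : Prop where
  positive : ∀ x : M, (x : H →L[ℂ] H).IsPositive → (E x : H →L[ℂ] H).IsPositive
  projection : ∀ n : N, E (StarSubalgebra.inclusion h n) = n
  bimodule : ∀ (m n : N) (x : M),
    E (StarSubalgebra.inclusion h m * x * StarSubalgebra.inclusion h n) = m * E x * n

end VonNeumann

/-! ### Stochastic processes -/

/-- A (unital) stochastic process labelled by `J` with sample algebra `𝔄`, on the Hilbert space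
`H`: unital `*`-homomorphisms `ι j : 𝔄 → B(H)` and a unit vector `Ω` which is cyclic for
the von Neumann algebra generated by the ranges of all the `ι j`. -/
structure StochasticProcess (𝔄 : Type*) [Ring 𝔄] [Algebra ℂ 𝔄] [StarRing 𝔄] (J : Type*)
    (H : Type*) [NormedAddCommGroup H] [InnerProductSpace ℂ H] [CompleteSpace H] where
  ι : J → 𝔄 →⋆ₐ[ℂ] (H →L[ℂ] H)
  Ω : H
  norm_Ω : ‖Ω‖ = 1
  cyclic : Dense {v : H | ∃ X ∈ vonNeumannGen (⋃ j, Set.range (ι j)), v = X Ω}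

namespace StochasticProcess

variable {𝔄 : Type*} [Ring 𝔄] [Algebra ℂ 𝔄] [StarRing 𝔄] {J : Type*}
  {H : Type*} [NormedAddCommGroup H] [InnerProductSpace ℂ H] [CompleteSpace H]
  (P : StochasticProcess 𝔄 J H)

/-- The vector state `X ↦ ⟨X Ω, Ω⟩` (linear in the first argument in the notation used here;
Mathlib's inner product is linear in the second). -/
def vectorState (X : H →L[ℂ] H) : ℂ := inner ℂ P.Ω (X P.Ω)

/-- The von Neumann algebra `⋁_{i ∈ I} ι_i(𝔄)`. -/
def localAlgebra (I : Set J) : StarSubalgebra ℂ (H →L[ℂ] H) :=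
  vonNeumannGen (⋃ i ∈ I, Set.range (P.ι i))

/-- The von Neumann algebra `M = ⋁_{j ∈ J} ι_j(𝔄)` of the process. -/
def algebra : StarSubalgebra ℂ (H →L[ℂ] H) := P.localAlgebra Set.univ

theorem localAlgebra_le (I : Set J) : P.localAlgebra I ≤ P.algebra :=
  vonNeumannGen_mono (Set.biUnion_subset_biUnion_left (Set.subset_univ I))

theorem ι_mem (j : J) (a : 𝔄) : P.ι j a ∈ P.algebra :=
  subset_vonNeumannGen _ (Set.mem_biUnion (Set.mem_univ j) ⟨a, rfl⟩)

/-- The process is exchangeable: all mixed moments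
`⟨ι_{j₁}(A₁) ⋯ ι_{jₙ}(Aₙ) Ω, Ω⟩` are invariant under the permutations of `J` moving only
finitely many indices. -/
def IsExchangeable : Prop :=
  ∀ g : Equiv.Perm J, {j | g j ≠ j}.Finite → ∀ l : List (J × 𝔄),
    P.vectorState (l.map fun p => P.ι p.1 p.2).prod =
      P.vectorState (l.map fun p => P.ι (g p.1) p.2).prod

/-- The tail algebra `⋂_{I finite} (⋃_{K finite, K ∩ I = ∅} ⋁_{k ∈ K} ι_k(𝔄))''`. -/
def tailAlgebra : StarSubalgebra ℂ (H →L[ℂ] H) :=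
  ⨅ I : Finset J, vonNeumannGen
    (⋃ (K : Finset J) (_ : Disjoint K I), (P.localAlgebra (K : Set J) : Set (H →L[ℂ] H)))

theorem tailAlgebra_le : P.tailAlgebra ≤ P.algebra := by
  refine (iInf_le _ (∅ : Finset J)).trans (vonNeumannGen_le ?_)
  exact Set.iUnion₂_subset fun K _ => P.localAlgebra_le K

/-- The process is conditionally independent and identically distributed with respect to its
tail algebra: there is a conditional expectation of `M` onto the tail algebra which preserves the
vector state of `Ω` and satisfies (i) independence and (ii) identical distribution. -/
def IsConditionallyIID : Prop :=
  ∃ E : P.algebra →ₗ[ℂ] P.tailAlgebra,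
    IsConditionalExpectation P.tailAlgebra_le E ∧
    (∀ X : P.algebra, P.vectorState (E X) = P.vectorState X) ∧
    (∀ I K : Finset J, Disjoint I K → ∀ X Y : P.algebra,
      (X : H →L[ℂ] H) ∈ vonNeumannGen
        ((P.localAlgebra (I : Set J) : Set (H →L[ℂ] H)) ∪ (P.tailAlgebra : Set (H →L[ℂ] H))) →
      (Y : H →L[ℂ] H) ∈ vonNeumannGen
        ((P.localAlgebra (K : Set J) : Set (H →L[ℂ] H)) ∪ (P.tailAlgebra : Set (H →L[ℂ] H))) →
      P.vectorState ((X : H →L[ℂ] H) * Y) = P.vectorState ((E X : H →L[ℂ] H) * E Y)) ∧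
    (∀ (i k : J) (A : 𝔄), E ⟨P.ι i A, P.ι_mem i A⟩ = E ⟨P.ι k A, P.ι_mem k A⟩)

end StochasticProcess

/-! ### The Boolean algebra `K(ℓ²({#} ∪ ℕ)) + ℂ I` and its embeddings -/

/-- The Hilbert space `ℓ²({#} ∪ ℕ)`; the point `#` is `none`, and `j : ℕ` is `some j`. -/
abbrev FockSpace : Type := lp (fun _ : Option ℕ => ℂ) 2

section Compact

variable {H : Type*} [NormedAddCommGroup H] [InnerProductSpace ℂ H] [CompleteSpace H]

theorem isCompactOperator_star {T : H →L[ℂ] H} (hT : IsCompactOperator T) :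
    IsCompactOperator (star T : H →L[ℂ] H) := by
  have hTT : IsCompactOperator (T * star T : H →L[ℂ] H) := hT.comp_clm (star T : H →L[ℂ] H)
  have hTT := hTT.isCompact_closure_image_closedBall (𝕜₁ := ℂ) (σ₁₂ := RingHom.id ℂ)
    (f := (T * star T : H →L[ℂ] H).toLinearMap) 1
  refine (isCompactOperator_iff_isCompact_closure_image_closedBall (𝕜₁ := ℂ) (𝕜₂ := ℂ)
    (σ₁₂ := RingHom.id ℂ) (star T : H →L[ℂ] H).toLinearMap one_pos).2 ?_
  refine TotallyBounded.isCompact_of_isClosed (TotallyBounded.closure ?_) isClosed_closure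
  have h1 : TotallyBounded ((T * star T : H →L[ℂ] H) '' Metric.closedBall 0 1) :=
    hTT.totallyBounded.subset subset_closure
  rw [Metric.totallyBounded_iff]
  intro ε hε
  obtain ⟨t, hts, htf, hcov⟩ := Metric.finite_approx_of_totallyBounded h1 (ε ^ 2 / 2) (by positivity)
  have hts' : ∀ y ∈ t, ∃ x ∈ Metric.closedBall (0 : H) 1, (T * star T : H →L[ℂ] H) x = y :=
    fun y hy => hts hy
  choose! f hf hf' using hts'
  refine ⟨(fun y => (star T : H →L[ℂ] H) (f y)) '' t, htf.image _, ?_⟩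
  rintro _ ⟨x, hx, rfl⟩
  obtain ⟨y, hy, hxy⟩ := Set.mem_iUnion₂.1 (hcov ⟨x, hx, rfl⟩)
  refine Set.mem_biUnion (Set.mem_image_of_mem _ hy) ?_
  have hfy := hf y hy
  rw [mem_closedBall_zero_iff] at hx hfy
  rw [← hf' y hy, Metric.mem_ball, dist_eq_norm, ← map_sub] at hxy
  rw [Metric.mem_ball, dist_eq_norm, ContinuousLinearMap.coe_coe, ← map_sub]
  have h2 : ‖x - f y‖ ≤ 2 := (norm_sub_le _ _).trans (by linarith)
  have h3 : ‖(star T : H →L[ℂ] H) (x - f y)‖ ^ 2 ≤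
      ‖(T * star T : H →L[ℂ] H) (x - f y)‖ * ‖x - f y‖ := by
    rw [← inner_self_eq_norm_sq (𝕜 := ℂ)]
    rw [ContinuousLinearMap.star_eq_adjoint, ContinuousLinearMap.adjoint_inner_right]
    exact (RCLike.re_le_norm _).trans (norm_inner_le_norm _ _)
  have h4 : ‖(T * star T : H →L[ℂ] H) (x - f y)‖ * ‖x - f y‖ ≤
      ‖(T * star T : H →L[ℂ] H) (x - f y)‖ * 2 := by gcongr
  exact lt_of_pow_lt_pow_left₀ 2 hε.le (by linarith)

end Compact

/-- The Boolean algebra: the unital `C*`-algebra of all operators `K + c I` on `ℓ²({#} ∪ ℕ)` with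
`K` compact and `c ∈ ℂ`. -/
def booleanAlgebra : StarSubalgebra ℂ (FockSpace →L[ℂ] FockSpace) where
  carrier := {x | ∃ (K : FockSpace →L[ℂ] FockSpace) (c : ℂ),
    IsCompactOperator K ∧ x = K + c • 1}
  mul_mem' := by
    rintro _ _ ⟨K, c, hK, rfl⟩ ⟨L, d, hL, rfl⟩
    refine ⟨K * L + d • K + c • L, c * d, ?_, ?_⟩
    · exact ((hK.comp_clm L).add (hK.smul d)).add (hL.smul c)
    · simp only [mul_add, add_mul, smul_mul_assoc, mul_smul_comm, one_mul, mul_one, smul_add, smul_smul]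
      rw [mul_comm d c]
      abel
  add_mem' := by
    rintro _ _ ⟨K, c, hK, rfl⟩ ⟨L, d, hL, rfl⟩
    exact ⟨K + L, c + d, hK.add hL, by rw [add_smul]; abel⟩
  algebraMap_mem' c := ⟨0, c, isCompactOperator_zero, by
    rw [zero_add, Algebra.algebraMap_eq_smul_one]⟩
  star_mem' := by
    rintro _ ⟨K, c, hK, rfl⟩
    exact ⟨star K, star c, isCompactOperator_star hK, by simp [star_add, star_smul]⟩

/-- The canonical basis vectors of `ℓ²({#} ∪ ℕ)`. -/
def basisVec (m : Option ℕ) : FockSpace := lp.single 2 m 1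

/-- The matrix units `ε_{mn} = ⟨ · , e_n⟩ e_m`. -/
def matrixUnit (m n : Option ℕ) : FockSpace →L[ℂ] FockSpace :=
  InnerProductSpace.rankOne ℂ (basisVec m) (basisVec n)

/-- The orthogonal projection onto `ℓ²(ℕ \ {j})`, that is onto the orthogonal complement of
`span {e_#, e_j}`. -/
def projCompl (j : ℕ) : FockSpace →L[ℂ] FockSpace :=
  1 - matrixUnit none none - matrixUnit (some j) (some j)

theorem inner_basisVec (m n : Option ℕ) :
    inner ℂ (basisVec m) (basisVec n) = if m = n then (1 : ℂ) else 0 := by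
  rw [basisVec, basisVec, lp.inner_single_left, lp.single_apply]
  by_cases h : m = n
  · subst h; simp
  · simp [h]

theorem matrixUnit_mul (m n p q : Option ℕ) :
    matrixUnit m n * matrixUnit p q = if n = p then matrixUnit m q else 0 := by
  change (matrixUnit m n).comp (matrixUnit p q) = _
  rw [matrixUnit, matrixUnit, InnerProductSpace.rankOne_comp_rankOne, inner_basisVec]
  split_ifs <;> simp [matrixUnit]

theorem star_matrixUnit (m n : Option ℕ) : star (matrixUnit m n) = matrixUnit n m := by
  rw [ContinuousLinearMap.star_eq_adjoint, matrixUnit, InnerProductSpace.adjoint_rankOne]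
  rfl

theorem isCompactOperator_matrixUnit (m n : Option ℕ) : IsCompactOperator (matrixUnit m n) := by
  have h : IsCompactOperator (innerSL ℂ (basisVec n)) :=
    isCompactOperator_of_locallyCompactSpace_dom (innerSL ℂ (basisVec n))
  exact h.clm_comp (ContinuousLinearMap.toSpanSingleton ℂ (basisVec m))

/-- The sample algebra `M₂(ℂ) ⊕ ℂ`. -/
abbrev SampleAlgebra : Type := Matrix (Fin 2) (Fin 2) ℂ × ℂ

/-- The operator `a ε_{##} + b ε_{#j} + c ε_{j#} + d ε_{jj} + β P_{ℕ \ {j}}` attached to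
`A = (a b; c d) ⊕ β`. -/
def embeddingOp (j : ℕ) (A : SampleAlgebra) : FockSpace →L[ℂ] FockSpace :=
  A.1 0 0 • matrixUnit none none + A.1 0 1 • matrixUnit none (some j) +
    A.1 1 0 • matrixUnit (some j) none + A.1 1 1 • matrixUnit (some j) (some j) +
    A.2 • projCompl j

theorem embeddingOp_mem (j : ℕ) (A : SampleAlgebra) : embeddingOp j A ∈ booleanAlgebra := by
  have h : ∀ m n, matrixUnit m n ∈ booleanAlgebra := fun m n =>
    ⟨_, 0, isCompactOperator_matrixUnit m n, by simp⟩
  have h1 : projCompl j ∈ booleanAlgebra :=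
    sub_mem (sub_mem (one_mem _) (h _ _)) (h _ _)
  exact add_mem (add_mem (add_mem (add_mem (SMulMemClass.smul_mem _ (h _ _))
    (SMulMemClass.smul_mem _ (h _ _))) (SMulMemClass.smul_mem _ (h _ _)))
    (SMulMemClass.smul_mem _ (h _ _))) (SMulMemClass.smul_mem _ h1)

/-- The unital embedding `ι_j` of `M₂(ℂ) ⊕ ℂ` into the Boolean algebra. -/
def booleanEmbedding (j : ℕ) : SampleAlgebra →⋆ₐ[ℂ] booleanAlgebra where
  toFun A := ⟨embeddingOp j A, embeddingOp_mem j A⟩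
  map_one' := by
    apply Subtype.ext
    simp [embeddingOp, projCompl]
  map_mul' A B := by
    apply Subtype.ext
    simp only [embeddingOp, projCompl, MulMemClass.mk_mul_mk, Prod.fst_mul, Prod.snd_mul,
      Matrix.mul_apply, Fin.sum_univ_two, mul_add, add_mul, mul_sub, sub_mul, smul_mul_assoc,
      mul_smul_comm, one_mul, mul_one, matrixUnit_mul, smul_sub, add_smul, mul_smul]
    simp
    module
  map_zero' := by
    apply Subtype.ext
    simp [embeddingOp]
  map_add' A B := by
    apply Subtype.ext
    simp only [embeddingOp, AddMemClass.mk_add_mk, Prod.fst_add, Prod.snd_add, Matrix.add_apply,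
      add_smul]
    abel
  commutes' c := by
    apply Subtype.ext
    simp only [embeddingOp, projCompl, Algebra.algebraMap_eq_smul_one]
    simp [smul_sub]
  map_star' A := by
    apply Subtype.ext
    simp only [embeddingOp, projCompl, StarMemClass.coe_star, star_add, star_smul, star_sub,
      star_one, star_matrixUnit, Prod.fst_star, Prod.snd_star, Matrix.star_apply]
    abel

/-- A state on the Boolean algebra: a positive linear functional with `ω(I) = 1`. -/
structure IsState (ω : booleanAlgebra →ₗ[ℂ] ℂ) : Prop where
  positive : ∀ x : booleanAlgebra, 0 ≤ ω (star x * x)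
  map_one : ω 1 = 1

/-- `P` is the Boolean stochastic process given by the state `ω`: there is a unital
`*`-representation `π` of the Boolean algebra on the Hilbert space of `P` such that
`(H, π, Ω)` is the Gelfand-Naimark-Segal triple of `ω` (unique up to unitary equivalence) and
the homomorphisms of `P` are `π ∘ ι_j`. Cyclicity of `Ω` is part of `P`. -/
def IsBooleanProcess {H : Type*} [NormedAddCommGroup H] [InnerProductSpace ℂ H] [CompleteSpace H]
    (ω : booleanAlgebra →ₗ[ℂ] ℂ) (P : StochasticProcess SampleAlgebra ℕ H) : Prop :=
  ∃ π : booleanAlgebra →⋆ₐ[ℂ] (H →L[ℂ] H),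
    (∀ x, ω x = P.vectorState (π x)) ∧ ∀ j, P.ι j = π.comp (booleanEmbedding j)

end BooleanDeFinetti

end

open scoped ComplexOrder

noncomputable section

namespace BooleanDeFinetti

/-! ### Commutants and limits of vector states -/

section General

variable {H : Type*} [NormedAddCommGroup H] [InnerProductSpace ℂ H]

/-! Write `e m n` for the image of the matrix unit under the representation. Either side of the
equivalence makes the expectation of `e (some j) (some j)` independent of `j`; these projections are
mutually orthogonal, so by Bessel the common value is zero (`unit_apply_Ω_eq_zero`). The rest is to
show that this vanishing implies both properties.

If it holds, then `Ω = vec none + rest`, where all matrix units kill `rest` and the vectors `vec m =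
e m none Ω` form an orthogonal family of equal norms. Together they span a dense subspace
(`dense_span`). The embedding `ι j` mixes only `vec none` and `vec (some j)`, and acts by the
character `A ↦ A.2` on the remaining vectors. Exchangeability is then visible: permuting the `vec
(some k)` fixes both components of `Ω`.

An element of the tail commutes with the rank one operators between vectors on which almost all
embeddings act by that character. Hence it is scalar off the vacuum, and the tail is spanned by `e
none none` and its complement (`exists_tail_eq`). The expectation is `E X = φ(X) e_## + ψ(X) (1 -
e_##)`, with `φ` the vacuum state and `ψ` the vector state of `rest`. If `rest = 0`, `ψ` is a limit
of the vector states of `vec (some i)` along a free ultrafilter. Independence reduces to `φ(XY) =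
φ(X) φ(Y)` (`vacuumState_mul`) and to `rest` being an eigenvector of all of `M`. -/

theorem commute_of_mem_vonNeumannGen [CompleteSpace H] {S : Set (H →L[ℂ] H)} {T X : H →L[ℂ] H}
    (h : ∀ s ∈ S, Commute s T) (h' : ∀ s ∈ S, Commute (star s) T) (hX : X ∈ vonNeumannGen S) :
    Commute X T := by
  rw [vonNeumannGen, StarSubalgebra.mem_centralizer_iff] at hX
  refine ((hX T ?_).1).symm
  rw [SetLike.mem_coe, StarSubalgebra.mem_centralizer_iff]
  exact fun s hs => ⟨h s hs, h' s hs⟩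

/-- Limits along a free ultrafilter of the vector states given by a sequence of unit vectors. -/
theorem exists_limit_vectorState (u : ℕ → H) (hu : ∀ i, ‖u i‖ = 1) :
    ∃ ψ : (H →L[ℂ] H) →ₗ[ℂ] ℂ, ∀ X : H →L[ℂ] H,
      Filter.Tendsto (fun i => inner ℂ (u i) (X (u i))) (Filter.hyperfilter ℕ : Filter ℕ)
        (nhds (ψ X)) := by
  have key : ∀ X : H →L[ℂ] H, ∃ z : ℂ,
      Filter.Tendsto (fun i => inner ℂ (u i) (X (u i))) (Filter.hyperfilter ℕ : Filter ℕ)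
        (nhds z) := by
    intro X
    have hmem : ∀ i, inner ℂ (u i) (X (u i)) ∈ Metric.closedBall (0 : ℂ) ‖X‖ := by
      intro i
      rw [mem_closedBall_zero_iff]
      calc ‖inner ℂ (u i) (X (u i))‖ ≤ ‖u i‖ * ‖X (u i)‖ := norm_inner_le_norm _ _
        _ ≤ ‖u i‖ * (‖X‖ * ‖u i‖) := by gcongr; exact X.le_opNorm _
        _ = ‖X‖ := by rw [hu]; ring
    obtain ⟨z, -, hz⟩ := (isCompact_closedBall (0 : ℂ) ‖X‖).ultrafilter_le_nhds'
      ((Filter.hyperfilter ℕ).map fun i => inner ℂ (u i) (X (u i)))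
      (Filter.mem_map.2 (Filter.univ_mem' hmem))
    exact ⟨z, hz⟩
  choose f hf using key
  refine ⟨{ toFun := f, map_add' := fun X Y => ?_, map_smul' := fun c X => ?_ }, hf⟩
  · refine tendsto_nhds_unique (hf _) (((hf X).add (hf Y)).congr fun i => ?_)
    simp
  · refine tendsto_nhds_unique (hf _) (((hf X).const_mul c).congr fun i => ?_)
    simp

/-- Operators commuting with the rank one operator of `u` have `u` as an eigenvector. -/
theorem inner_smul_apply_of_commute_rankOne {X : H →L[ℂ] H} {u u' : H}
    (h : Commute X (InnerProductSpace.rankOne ℂ u u')) :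
    inner ℂ u' u' • X u = inner ℂ u' (X u') • u := by
  have := congrArg (fun T : H →L[ℂ] H => T u') h.eq
  simpa [InnerProductSpace.rankOne_apply] using this

end General

/-! ### Local algebras, tail algebra and cyclicity -/

namespace StochasticProcess

variable {𝔄 : Type*} [Ring 𝔄] [Algebra ℂ 𝔄] [StarRing 𝔄] {J : Type*}
  {H : Type*} [NormedAddCommGroup H] [InnerProductSpace ℂ H] [CompleteSpace H]
  {P : StochasticProcess 𝔄 J H}

theorem star_mem_localGenerators {I : Set J} {s : H →L[ℂ] H}
    (hs : s ∈ ⋃ i ∈ I, Set.range (P.ι i)) : ∃ i ∈ I, ∃ A, s = P.ι i A ∧ star s = P.ι i (star A) := by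
  obtain ⟨i, hi, A, rfl⟩ := Set.mem_iUnion₂.1 hs
  exact ⟨i, hi, A, rfl, (map_star _ _).symm⟩

theorem commute_of_mem_localAlgebra {I : Set J} {T X : H →L[ℂ] H}
    (h : ∀ i ∈ I, ∀ A, Commute (P.ι i A) T) (hX : X ∈ P.localAlgebra I) : Commute X T := by
  refine commute_of_mem_vonNeumannGen ?_ ?_ hX <;> intro s hs <;>
    obtain ⟨i, hi, A, hA, hA'⟩ := star_mem_localGenerators hs
  · exact hA ▸ h i hi A
  · exact hA' ▸ h i hi _

/-- The tail lies in the bicommutant of the algebras with index outside `I`, so finitely many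
embeddings may fail to commute with `T`. This bounds the tail from above. -/
theorem commute_of_mem_tailAlgebra (I : Finset J) {T X : H →L[ℂ] H}
    (h : ∀ i ∉ I, ∀ A, Commute (P.ι i A) T) (hX : X ∈ P.tailAlgebra) : Commute X T := by
  rw [tailAlgebra, StarSubalgebra.mem_iInf] at hX
  have hK : ∀ K : Finset J, Disjoint K I → ∀ s ∈ P.localAlgebra (K : Set J), Commute s T :=
    fun K hK s hs => commute_of_mem_localAlgebra
      (fun i hi => h i (Finset.disjoint_left.1 hK (Finset.mem_coe.1 hi))) hs
  refine commute_of_mem_vonNeumannGen ?_ ?_ (hX I) <;> intro s hs <;>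
    obtain ⟨K, hKI, hs⟩ := Set.mem_iUnion₂.1 hs
  · exact hK K hKI s hs
  · exact hK K hKI _ (star_mem hs)

theorem commute_of_mem_localAlgebra_sup_tail {I : Set J} {T X : H →L[ℂ] H}
    (h : ∀ i ∈ I, ∀ A, Commute (P.ι i A) T) (h' : ∀ Z ∈ P.tailAlgebra, Commute Z T)
    (hX : X ∈ vonNeumannGen
      ((P.localAlgebra I : Set (H →L[ℂ] H)) ∪ (P.tailAlgebra : Set (H →L[ℂ] H)))) :
    Commute X T := by
  have key : ∀ s ∈ (P.localAlgebra I : Set (H →L[ℂ] H)) ∪ (P.tailAlgebra : Set (H →L[ℂ] H)),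
      Commute s T := by
    rintro s (hs | hs)
    · exact commute_of_mem_localAlgebra h hs
    · exact h' s hs
  refine commute_of_mem_vonNeumannGen key (fun s hs => key _ ?_) hX
  exact hs.imp (fun hs => star_mem (S := StarSubalgebra ℂ (H →L[ℂ] H)) hs)
    (fun hs => star_mem (S := StarSubalgebra ℂ (H →L[ℂ] H)) hs)

theorem mem_tailAlgebra [Infinite J] {X : H →L[ℂ] H} (h : ∀ j, X ∈ Set.range (P.ι j)) :
    X ∈ P.tailAlgebra := by
  rw [tailAlgebra, StarSubalgebra.mem_iInf]
  intro I
  obtain ⟨j, hj⟩ := Infinite.exists_notMem_finset I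
  refine subset_vonNeumannGen _ (Set.mem_iUnion₂.2
    ⟨{j}, Finset.disjoint_singleton_left.2 hj, subset_vonNeumannGen _ ?_⟩)
  exact Set.mem_biUnion (by simp) (h j)

/-- A closed subspace which contains `Ω` and is invariant under the process is everything. -/
theorem eq_top_of_invariant (V : Submodule ℂ H) (hV : IsClosed (V : Set H)) (hΩ : P.Ω ∈ V)
    (h : ∀ j A, ∀ x ∈ V, P.ι j A x ∈ V) : V = ⊤ := by
  have : CompleteSpace V := hV.completeSpace_coe
  -- The ranges of the embeddings are closed under adjoints, so the orthogonal complement of `V` is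
  -- invariant too.
  have hcomm : ∀ j A, Commute (P.ι j A) V.starProjection := by
    intro j A
    refine ContinuousLinearMap.ext fun x => ?_
    change P.ι j A (V.starProjection x) = V.starProjection (P.ι j A x)
    refine (Submodule.eq_starProjection_of_mem_orthogonal
      (h j A _ (V.starProjection_apply_mem x)) ?_).symm
    rw [← map_sub, Submodule.mem_orthogonal]
    intro y hy
    rw [← ContinuousLinearMap.adjoint_inner_left, ← ContinuousLinearMap.star_eq_adjoint,
      ← map_star]
    exact Submodule.inner_right_of_mem_orthogonal (h j _ y hy)
      (V.sub_starProjection_mem_orthogonal x)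
  have hall : ∀ X ∈ P.algebra, X P.Ω ∈ V := by
    intro X hX
    have := congrArg (fun T : H →L[ℂ] H => T P.Ω)
      (commute_of_mem_localAlgebra (fun i _ A => hcomm i A) hX).eq
    simp only [mul_apply_eq_comp, V.starProjection_eq_self_iff.2 hΩ] at this
    exact this ▸ V.starProjection_apply_mem _
  refine (Submodule.eq_top_iff').2 fun x => ?_
  have hsub : {v : H | ∃ X ∈ vonNeumannGen (⋃ j, Set.range (P.ι j)), v = X P.Ω} ⊆ V := by
    rintro _ ⟨X, hX, rfl⟩
    exact hall X (by rwa [algebra, localAlgebra, Set.biUnion_univ])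
  exact closure_minimal hsub hV (P.cyclic x)

end StochasticProcess

/-! ### Matrix units and the vanishing of their diagonal expectations -/

variable {H : Type*} [NormedAddCommGroup H] [InnerProductSpace ℂ H] [CompleteSpace H]

/-- The process `P` is built from the system of matrix units `e` by the formula of the Boolean
embeddings. -/
structure IsMatrixUnitProcess (P : StochasticProcess SampleAlgebra ℕ H)
    (e : Option ℕ → Option ℕ → H →L[ℂ] H) : Prop where
  mul : ∀ m n p q, e m n * e p q = if n = p then e m q else 0
  star : ∀ m n, star (e m n) = e n m
  ι_eq : ∀ j A, P.ι j A = A.1 0 0 • e none none + A.1 0 1 • e none (some j) +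
    A.1 1 0 • e (some j) none + A.1 1 1 • e (some j) (some j) +
    A.2 • (1 - e none none - e (some j) (some j))

/-- Reduces the representation to its matrix units: from here on only their relations, the formula
for `ι` and cyclicity matter. -/
theorem IsBooleanProcess.exists_isMatrixUnitProcess {ω : booleanAlgebra →ₗ[ℂ] ℂ}
    {P : StochasticProcess SampleAlgebra ℕ H} (hP : IsBooleanProcess ω P) :
    ∃ e, IsMatrixUnitProcess P e := by
  obtain ⟨π, -, hι⟩ := hP
  let ε (m n : Option ℕ) : booleanAlgebra :=
    ⟨matrixUnit m n, matrixUnit m n, 0, isCompactOperator_matrixUnit m n, by simp⟩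
  refine ⟨fun m n => π (ε m n), fun m n p q => ?_, fun m n => ?_, fun j A => ?_⟩
  · have h : ε m n * ε p q = if n = p then ε m q else 0 := by
      apply Subtype.ext
      change matrixUnit m n * matrixUnit p q = _
      rw [matrixUnit_mul]
      split_ifs <;> rfl
    rw [← map_mul, h]
    split_ifs <;> simp
  · rw [← map_star]
    exact congrArg π (Subtype.ext (star_matrixUnit m n))
  · have h : booleanEmbedding j A = A.1 0 0 • ε none none + A.1 0 1 • ε none (some j) +
        A.1 1 0 • ε (some j) none + A.1 1 1 • ε (some j) (some j) +
        A.2 • (1 - ε none none - ε (some j) (some j)) := Subtype.ext rfl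
    rw [hι, StarAlgHom.comp_apply, h]
    simp only [map_add, map_sub, map_smul, map_one]

namespace IsMatrixUnitProcess

variable {P : StochasticProcess SampleAlgebra ℕ H} {e : Option ℕ → Option ℕ → H →L[ℂ] H}
  (he : IsMatrixUnitProcess P e)

include he

theorem apply_apply (m n p q : Option ℕ) (x : H) :
    e m n (e p q x) = if n = p then e m q x else 0 := by
  have := congrArg (fun T : H →L[ℂ] H => T x) (he.mul m n p q)
  change e m n (e p q x) = _ at this
  rw [this]
  split_ifs <;> rfl

theorem inner_apply_left (m n : Option ℕ) (x y : H) :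
    inner ℂ (e m n x) y = inner ℂ x (e n m y) := by
  rw [← he.star m n, ContinuousLinearMap.star_eq_adjoint, ContinuousLinearMap.adjoint_inner_right]

/-- The matrix unit `e_{##}` belongs to every local algebra. -/
theorem unit_none_eq (j : ℕ) : P.ι j (Matrix.single 0 0 1, 0) = e none none := by
  simp [he.ι_eq]

theorem unit_some_eq (j : ℕ) : P.ι j (Matrix.single 1 1 1, 0) = e (some j) (some j) := by
  simp [he.ι_eq]

theorem isStarProjection (m : Option ℕ) : IsStarProjection (e m m) :=
  ⟨by rw [IsIdempotentElem, he.mul, if_pos rfl], he.star m m⟩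

theorem vectorState_unit (m : Option ℕ) :
    P.vectorState (e m m) = ((‖e m m P.Ω‖ ^ 2 : ℝ) : ℂ) := by
  have h : inner ℂ (e m m P.Ω) (e m m P.Ω) = P.vectorState (e m m) := by
    rw [he.inner_apply_left, he.apply_apply, if_pos rfl]; rfl
  rw [← h, inner_self_eq_norm_sq_to_K]
  norm_cast

/-- Bessel's inequality: with `y` the sum of the `e m m Ω` and `S` the sum of squares, orthogonality
gives `‖y‖² = ⟪y, Ω⟫ = S`, and Cauchy–Schwarz gives `S ≤ ‖y‖`. -/
theorem sum_norm_sq_le (s : Finset (Option ℕ)) : ∑ m ∈ s, ‖e m m P.Ω‖ ^ 2 ≤ 1 := by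
  have horth : ∀ m n, m ≠ n → inner ℂ (e m m P.Ω) (e n n P.Ω) = 0 := fun m n h => by
    rw [he.inner_apply_left, he.apply_apply, if_neg h, inner_zero_right]
  set y := ∑ m ∈ s, e m m P.Ω with hy
  have h1 : inner ℂ y y = ((∑ m ∈ s, ‖e m m P.Ω‖ ^ 2 : ℝ) : ℂ) := by
    rw [hy, sum_inner]
    push_cast
    refine Finset.sum_congr rfl fun m hm => ?_
    rw [inner_sum, Finset.sum_eq_single_of_mem m hm fun n _ hn => horth m n hn.symm,
      inner_self_eq_norm_sq_to_K]
    rfl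
  have h2 : inner ℂ y P.Ω = ((∑ m ∈ s, ‖e m m P.Ω‖ ^ 2 : ℝ) : ℂ) := by
    rw [hy, sum_inner]
    push_cast
    refine Finset.sum_congr rfl fun m _ => ?_
    rw [he.inner_apply_left]
    simpa [StochasticProcess.vectorState] using he.vectorState_unit m
  set S := ∑ m ∈ s, ‖e m m P.Ω‖ ^ 2
  have hS : 0 ≤ S := Finset.sum_nonneg fun _ _ => by positivity
  have h3 : ‖y‖ ^ 2 = S := by
    rw [inner_self_eq_norm_sq_to_K] at h1
    exact Complex.ofReal_injective ((Complex.ofReal_pow _ _).trans h1)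
  have h4 : S ≤ ‖y‖ := by
    have := norm_inner_le_norm (𝕜 := ℂ) y P.Ω
    rwa [h2, P.norm_Ω, mul_one, Complex.norm_real, Real.norm_of_nonneg hS] at this
  nlinarith [norm_nonneg y]

/-- If the diagonal matrix units have the same expectation then this expectation vanishes. -/
theorem unit_apply_Ω_eq_zero (h : ∀ i j : ℕ,
      P.vectorState (e (some i) (some i)) = P.vectorState (e (some j) (some j))) (j : ℕ) :
    e (some j) (some j) P.Ω = 0 := by
  by_contra hj
  have hpos : 0 < ‖e (some j) (some j) P.Ω‖ ^ 2 := by positivity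
  have hconst : ∀ i, ‖e (some i) (some i) P.Ω‖ ^ 2 = ‖e (some j) (some j) P.Ω‖ ^ 2 := fun i => by
    have := h i j
    rw [he.vectorState_unit, he.vectorState_unit] at this
    exact_mod_cast this
  obtain ⟨n, hn⟩ := exists_nat_gt (1 / ‖e (some j) (some j) P.Ω‖ ^ 2)
  have := he.sum_norm_sq_le ((Finset.range n).map Function.Embedding.some)
  rw [Finset.sum_map] at this
  simp only [Function.Embedding.some_apply, hconst, Finset.sum_const, Finset.card_range,
    nsmul_eq_mul] at this
  rw [div_lt_iff₀ hpos] at hn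
  linarith

/-- One-point moments and transpositions suffice. -/
theorem unit_apply_Ω_eq_zero_of_isExchangeable (h : P.IsExchangeable) (j : ℕ) :
    e (some j) (some j) P.Ω = 0 := by
  refine he.unit_apply_Ω_eq_zero (fun i k => ?_) j
  have := h (Equiv.swap i k) ?_ [(i, (Matrix.single 1 1 1, 0))]
  · simpa [he.unit_some_eq] using this
  · refine (Set.toFinite {i, k}).subset fun x hx => ?_
    by_contra hx'
    simp only [Set.mem_insert_iff, Set.mem_singleton_iff, not_or] at hx'
    exact hx (Equiv.swap_apply_of_ne_of_ne hx'.1 hx'.2)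

/-- Identical distribution and preservation of the vector state suffice; independence plays no role.
-/
theorem unit_apply_Ω_eq_zero_of_isConditionallyIID (h : P.IsConditionallyIID) (j : ℕ) :
    e (some j) (some j) P.Ω = 0 := by
  obtain ⟨E, -, hE, -, hid⟩ := h
  refine he.unit_apply_Ω_eq_zero (fun i k => ?_) j
  rw [← he.unit_some_eq, ← he.unit_some_eq, ← hE ⟨_, P.ι_mem i _⟩, ← hE ⟨_, P.ι_mem k _⟩, hid i k]

end IsMatrixUnitProcess

/-- The process `P` comes from the matrix units `e`, and its state vanishes on `e_{jj}` for all
`j : ℕ`. -/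
structure IsVacuumProcess (P : StochasticProcess SampleAlgebra ℕ H)
    (e : Option ℕ → Option ℕ → H →L[ℂ] H) : Prop extends IsMatrixUnitProcess P e where
  unit_Ω : ∀ j : ℕ, e (some j) (some j) P.Ω = 0

/-! ### Action on the vacuum vectors, and exchangeability -/

namespace IsVacuumProcess

variable (P : StochasticProcess SampleAlgebra ℕ H) (e : Option ℕ → Option ℕ → H →L[ℂ] H)

/-- The images `e_{m#} Ω` of the component of `Ω` in the vacuum. -/
def vec (m : Option ℕ) : H := e m none P.Ω

/-- The component of `Ω` orthogonal to the vacuum. -/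
def rest : H := P.Ω - e none none P.Ω

variable {P e}

theorem vec_add_rest : vec P e none + rest P e = P.Ω := by
  rw [vec, rest, add_sub_cancel]

variable (he : IsVacuumProcess P e)

include he

theorem unit_vec (m n k : Option ℕ) : e m n (vec P e k) = if n = k then vec P e m else 0 :=
  he.apply_apply m n k none P.Ω

theorem unit_rest (m n : Option ℕ) : e m n (rest P e) = 0 := by
  -- Since `e m (some j) = e m (some j) * e (some j) (some j)`, the left side vanishes for `n = some
  -- j`, as does the right.
  have h : e m n P.Ω = e m n (e none none P.Ω) := by
    rw [he.apply_apply]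
    cases n with
    | none => simp
    | some j =>
      have := he.apply_apply m (some j) (some j) (some j) P.Ω
      rw [he.unit_Ω, map_zero, if_pos rfl] at this
      simp [← this]
  rw [rest, map_sub, h, sub_self]

theorem ι_vec_of_ne (j k : ℕ) (h : j ≠ k) (A : SampleAlgebra) :
    P.ι j A (vec P e (some k)) = A.2 • vec P e (some k) := by
  simp [he.ι_eq, he.unit_vec, h]

theorem ι_vec_none (j : ℕ) (A : SampleAlgebra) :
    P.ι j A (vec P e none) = A.1 0 0 • vec P e none + A.1 1 0 • vec P e (some j) := by
  simp [he.ι_eq, he.unit_vec]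

theorem ι_vec_self (j : ℕ) (A : SampleAlgebra) :
    P.ι j A (vec P e (some j)) = A.1 0 1 • vec P e none + A.1 1 1 • vec P e (some j) := by
  simp [he.ι_eq, he.unit_vec]

theorem ι_rest (j : ℕ) (A : SampleAlgebra) : P.ι j A (rest P e) = A.2 • rest P e := by
  simp [he.ι_eq, he.unit_rest]

theorem inner_vec_vec (m n : Option ℕ) : inner ℂ (vec P e m) (vec P e n) =
    if m = n then inner ℂ (vec P e none) (vec P e none) else 0 := by
  have h : ∀ m n, inner ℂ (vec P e m) (vec P e n) =
      if m = n then inner ℂ P.Ω (e none none P.Ω) else 0 := fun m n => by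
    rw [vec, he.inner_apply_left, vec, he.apply_apply]
    split_ifs <;> simp
  rw [h m n, h none none, if_pos rfl]

theorem inner_rest_vec (m : Option ℕ) : inner ℂ (rest P e) (vec P e m) = 0 := by
  rw [vec, ← he.inner_apply_left, he.unit_rest, inner_zero_left]

theorem inner_vec_rest (m : Option ℕ) : inner ℂ (vec P e m) (rest P e) = 0 := by
  rw [inner_eq_zero_symm, he.inner_rest_vec]

theorem inner_Ω_vec (m : Option ℕ) : inner ℂ P.Ω (vec P e m) =
    if none = m then inner ℂ (vec P e none) (vec P e none) else 0 := by
  rw [← he.inner_vec_vec none m, ← sub_eq_zero, ← inner_sub_left]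
  exact he.inner_rest_vec m

theorem isExchangeable : P.IsExchangeable := by
  intro g _ l
  -- The span of `G` plays the part of the graph of the operator that permutes the `vec (some k)` by
  -- `g` and fixes `vec none` and `rest`. Working with the relation avoids constructing that
  -- operator.
  let G : Set (H × H) := insert (rest P e, rest P e)
    (Set.range fun m : Option ℕ => (vec P e m, vec P e (m.map g)))
  have hgen : ∀ m : Option ℕ, (vec P e m, vec P e (m.map g)) ∈ Submodule.span ℂ G :=
    fun m => Submodule.subset_span (Or.inr ⟨m, rfl⟩)
  have hrest : (rest P e, rest P e) ∈ Submodule.span ℂ G := Submodule.subset_span (Or.inl rfl)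
  have hinv : ∀ j A, ∀ x ∈ Submodule.span ℂ G,
      (P.ι j A x.1, P.ι (g j) A x.2) ∈ Submodule.span ℂ G := by
    intro j A x hx
    change ((P.ι j A).prodMap (P.ι (g j) A)) x ∈ _
    refine Submodule.span_le (p := (Submodule.span ℂ G).comap
      ((P.ι j A).prodMap (P.ι (g j) A)).toLinearMap) |>.2 ?_ hx
    rintro _ (rfl | ⟨m, rfl⟩)
    · change (P.ι j A (rest P e), P.ι (g j) A (rest P e)) ∈ Submodule.span ℂ G
      rw [he.ι_rest, he.ι_rest]
      exact Submodule.smul_mem _ A.2 hrest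
    · change (P.ι j A (vec P e m), P.ι (g j) A (vec P e (m.map g))) ∈ Submodule.span ℂ G
      rcases m with _ | k
      · simp only [Option.map_none, he.ι_vec_none]
        exact Submodule.add_mem _ (Submodule.smul_mem _ _ (hgen none))
          (Submodule.smul_mem _ _ (hgen (some j)))
      · by_cases hk : j = k
        · subst hk
          simp only [Option.map_some, he.ι_vec_self]
          exact Submodule.add_mem _ (Submodule.smul_mem _ _ (hgen none))
            (Submodule.smul_mem _ _ (hgen (some j)))
        · rw [Option.map_some, he.ι_vec_of_ne _ _ hk,
            he.ι_vec_of_ne _ _ (fun h => hk (g.injective h))]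
          exact Submodule.smul_mem _ _ (hgen (some k))
  have hprod : ((l.map fun p => P.ι p.1 p.2).prod P.Ω,
      (l.map fun p => P.ι (g p.1) p.2).prod P.Ω) ∈ Submodule.span ℂ G := by
    induction l with
    | nil =>
      have := Submodule.add_mem _ (hgen none) hrest
      simpa [vec_add_rest] using this
    | cons p l ih =>
      simpa using hinv p.1 p.2 _ ih
  have hinner : ∀ x ∈ Submodule.span ℂ G, inner ℂ P.Ω x.1 = inner ℂ P.Ω x.2 := by
    intro x hx
    induction hx using Submodule.span_induction with
    | mem x hx =>
      rcases hx with rfl | ⟨m, rfl⟩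
      · rfl
      · simp only [he.inner_Ω_vec]
        cases m <;> simp
    | zero => rfl
    | add x y _ _ hx hy => simp [hx, hy]
    | smul c x _ hx => simp [hx]
  exact hinner _ hprod

end IsVacuumProcess

/-- The adjoint of `ι j A` is `ι j (star A)`, which acts on `u'` by the conjugate of `A.2`; both
products are therefore `A.2` times the rank one operator. -/
theorem commute_rankOne {P : StochasticProcess SampleAlgebra ℕ H} {j : ℕ} {u u' : H}
    (hu : ∀ A, P.ι j A u = A.2 • u) (hu' : ∀ A, P.ι j A u' = A.2 • u') (A : SampleAlgebra) :
    Commute (P.ι j A) (InnerProductSpace.rankOne ℂ u u') := by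
  refine ContinuousLinearMap.ext fun x => ?_
  change P.ι j A (InnerProductSpace.rankOne ℂ u u' x) =
    InnerProductSpace.rankOne ℂ u u' (P.ι j A x)
  have h : inner ℂ u' (P.ι j A x) = A.2 * inner ℂ u' x := by
    rw [← ContinuousLinearMap.adjoint_inner_left, ← ContinuousLinearMap.star_eq_adjoint,
      ← map_star, hu', inner_smul_left]
    simp
  rw [InnerProductSpace.rankOne_apply, InnerProductSpace.rankOne_apply, h, map_smul, hu, smul_smul,
    mul_comm]

/-- Elements of the tail algebra act as the same scalar on all vectors on which all but finitely
many embeddings act by the character `A ↦ A.2`. -/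
theorem tail_apply {P : StochasticProcess SampleAlgebra ℕ H} {X : H →L[ℂ] H} (hX : X ∈ P.tailAlgebra) {u u' : H} {i i' : ℕ}
    (hu : ∀ k, k ≠ i → ∀ A, P.ι k A u = A.2 • u)
    (hu' : ∀ k, k ≠ i' → ∀ A, P.ι k A u' = A.2 • u') :
    inner ℂ u' u' • X u = inner ℂ u' (X u') • u := by
  refine inner_smul_apply_of_commute_rankOne (P.commute_of_mem_tailAlgebra {i, i'} ?_ hX)
  intro k hk A
  simp only [Finset.mem_insert, Finset.mem_singleton, not_or] at hk
  exact commute_rankOne (hu k hk.1) (hu' k hk.2) A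

/-- The vector state of the vacuum component `e_{##} Ω`, normalized unless it vanishes. -/
def vacuumState (P : StochasticProcess SampleAlgebra ℕ H)
    (e : Option ℕ → Option ℕ → H →L[ℂ] H) : (H →L[ℂ] H) →ₗ[ℂ] ℂ where
  toFun X := (inner ℂ (e none none P.Ω) (e none none P.Ω))⁻¹ *
    inner ℂ (e none none P.Ω) (X (e none none P.Ω))
  map_add' X Y := by simp [mul_add]
  map_smul' c X := by simp [mul_left_comm]

theorem vacuumState_apply (P : StochasticProcess SampleAlgebra ℕ H)
    (e : Option ℕ → Option ℕ → H →L[ℂ] H) (X : H →L[ℂ] H) :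
    vacuumState P e X = (inner ℂ (e none none P.Ω) (e none none P.Ω))⁻¹ *
      inner ℂ (e none none P.Ω) (X (e none none P.Ω)) := rfl

/-! ### Structure of the Hilbert space, the tail algebra and independence in the vacuum state -/

namespace IsVacuumProcess

variable {P : StochasticProcess SampleAlgebra ℕ H} {e : Option ℕ → Option ℕ → H →L[ℂ] H}
  (he : IsVacuumProcess P e)

include he

theorem dense_span : Dense
    (Submodule.span ℂ (insert (rest P e) (Set.range (vec P e))) : Set H) := by
  rw [Submodule.dense_iff_topologicalClosure_eq_top]
  set W := Submodule.span ℂ (insert (rest P e) (Set.range (vec P e))) with hW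
  have hvec : ∀ m, vec P e m ∈ W := fun m => Submodule.subset_span (Or.inr ⟨m, rfl⟩)
  have hrest : rest P e ∈ W := Submodule.subset_span (Or.inl rfl)
  refine P.eq_top_of_invariant _ W.isClosed_topologicalClosure
    (W.le_topologicalClosure ?_) fun j A x hx => ?_
  · rw [← vec_add_rest (P := P) (e := e)]
    exact W.add_mem (hvec none) hrest
  · refine map_mem_closure (P.ι j A).continuous hx fun y hy => ?_
    refine Submodule.span_le (p := W.comap (P.ι j A).toLinearMap) |>.2 ?_ hy
    rintro _ (rfl | ⟨m, rfl⟩)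
    · change P.ι j A (rest P e) ∈ W
      rw [he.ι_rest]
      exact W.smul_mem _ hrest
    · change P.ι j A (vec P e m) ∈ W
      rcases m with _ | k
      · rw [he.ι_vec_none]
        exact W.add_mem (W.smul_mem _ (hvec _)) (W.smul_mem _ (hvec _))
      · by_cases hk : j = k
        · subst hk
          rw [he.ι_vec_self]
          exact W.add_mem (W.smul_mem _ (hvec _)) (W.smul_mem _ (hvec _))
        · rw [he.ι_vec_of_ne _ _ hk]
          exact W.smul_mem _ (hvec _)

theorem ext {S T : H →L[ℂ] H} (h : ∀ m, S (vec P e m) = T (vec P e m))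
    (h' : S (rest P e) = T (rest P e)) : S = T := by
  refine ContinuousLinearMap.ext_on he.dense_span ?_
  rintro _ (rfl | ⟨m, rfl⟩)
  exacts [h', h m]

theorem eq_zero_of_inner {x : H} (h : ∀ m, inner ℂ (vec P e m) x = 0)
    (h' : inner ℂ (rest P e) x = 0) : x = 0 := by
  refine he.dense_span.eq_zero_of_inner_left ℂ fun y hy => ?_
  rw [inner_eq_zero_symm]
  induction hy using Submodule.span_induction with
  | mem y hy =>
    rcases hy with rfl | ⟨m, rfl⟩
    exacts [h', h m]
  | zero => exact inner_zero_left _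
  | add y z _ _ hy hz => rw [inner_add_left, hy, hz, add_zero]
  | smul c y _ hy => rw [inner_smul_left, hy, mul_zero]

/-- Both sides agree on the spanning vectors. If `vec none = 0`, the inverse is `0` by convention
and both sides vanish. -/
theorem vacuum_eq : e none none = (inner ℂ (vec P e none) (vec P e none))⁻¹ •
    InnerProductSpace.rankOne ℂ (vec P e none) (vec P e none) := by
  refine he.ext (fun m => ?_) ?_
  · rw [he.unit_vec, smul_apply, InnerProductSpace.rankOne_apply,
      he.inner_vec_vec none m]
    by_cases h : none = m
    · by_cases h0 : vec P e none = 0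
      · simp [h0]
      · rw [if_pos h, if_pos h, smul_smul, inv_mul_cancel₀, one_smul]
        exact inner_self_ne_zero.2 h0
    · simp [h]
  · rw [he.unit_rest, smul_apply, InnerProductSpace.rankOne_apply,
      he.inner_vec_rest, zero_smul, smul_zero]

theorem vacuum_apply_apply (X : H →L[ℂ] H) :
    e none none (X (vec P e none)) = vacuumState P e X • vec P e none := by
  conv_lhs => rw [he.vacuum_eq]
  rw [smul_apply, InnerProductSpace.rankOne_apply, smul_smul]
  rfl

theorem inner_vacuum_apply (X : H →L[ℂ] H) : inner ℂ (vec P e none) (X (vec P e none)) =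
    vacuumState P e X * inner ℂ (vec P e none) (vec P e none) := by
  rw [← inner_smul_right, ← he.vacuum_apply_apply, ← he.inner_apply_left, he.unit_vec, if_pos rfl]

/-- Unit vectors on which all but one of the embeddings act by the character `A ↦ A.2`. -/
theorem exists_unit_vectors : ∃ u : ℕ → H, (∀ i, ‖u i‖ = 1) ∧
    (∀ i k, k ≠ i → ∀ A, P.ι k A (u i) = A.2 • u i) ∧ (∀ i, e none none (u i) = 0) ∧
    (rest P e = 0 ∨ ∃ c : ℂ, ∀ i, u i = c • rest P e) := by
  -- If `rest = 0` then `vec none = Ω`, so every `vec (some i)` has norm one; otherwise the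
  -- normalized `rest` serves for all `i`.
  by_cases h : rest P e = 0
  · refine ⟨fun i => vec P e (some i), fun i => ?_, fun i k hk A => he.ι_vec_of_ne k i hk A,
      fun i => by simp [he.unit_vec], Or.inl h⟩
    have h1 := he.inner_vec_vec (some i) (some i)
    have h2 := vec_add_rest (P := P) (e := e)
    rw [h, add_zero] at h2
    rw [if_pos rfl, h2, inner_self_eq_norm_sq_to_K, inner_self_eq_norm_sq_to_K, P.norm_Ω] at h1
    have h3 : ‖vec P e (some i)‖ ^ 2 = 1 := by
      have := (Complex.ofReal_pow _ _).trans h1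
      exact Complex.ofReal_injective (by simpa using this)
    nlinarith [norm_nonneg (vec P e (some i))]
  · have hn : ‖rest P e‖ ≠ 0 := norm_ne_zero_iff.2 h
    refine ⟨fun _ => ((‖rest P e‖⁻¹ : ℝ) : ℂ) • rest P e, fun i => ?_, fun i k _ A => ?_,
      fun i => ?_, Or.inr ⟨_, fun i => rfl⟩⟩
    · rw [norm_smul, Complex.norm_real, norm_inv, norm_norm, inv_mul_cancel₀ hn]
    · rw [map_smul, he.ι_rest, smul_comm]
    · rw [map_smul, he.unit_rest, smul_zero]

/-- Every embedding acts on `rest` by a character, so all of `M` commutes with the rank one operator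
of `rest`. -/
theorem algebra_apply_rest {X : H →L[ℂ] H} (hX : X ∈ P.algebra) :
    inner ℂ (rest P e) (rest P e) • X (rest P e) =
      inner ℂ (rest P e) (X (rest P e)) • rest P e :=
  inner_smul_apply_of_commute_rankOne (P.commute_of_mem_localAlgebra
    (fun k _ A => commute_rankOne (he.ι_rest k) (he.ι_rest k) A) hX)

theorem exists_algebra_apply_rest {X : H →L[ℂ] H} (hX : X ∈ P.algebra) :
    ∃ c : ℂ, X (rest P e) = c • rest P e := by
  by_cases h : rest P e = 0
  · exact ⟨0, by simp [h]⟩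
  · refine ⟨(inner ℂ (rest P e) (rest P e))⁻¹ * inner ℂ (rest P e) (X (rest P e)), ?_⟩
    rw [mul_smul, ← he.algebra_apply_rest hX, smul_smul, inv_mul_cancel₀ (inner_self_ne_zero.2 h),
      one_smul]

theorem exists_tail_eq {X : H →L[ℂ] H} (hX : X ∈ P.tailAlgebra) :
    ∃ a c : ℂ, X = a • e none none + c • (1 - e none none) := by
  obtain ⟨u, hu1, hu, -, -⟩ := he.exists_unit_vectors
  have hu0 : inner ℂ (u 0) (u 0) = (1 : ℂ) := by
    rw [inner_self_eq_norm_sq_to_K, hu1]; simp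
  -- Comparison with the unit vector `u 0` yields one scalar for all such `v`, even if `rest` or the
  -- `vec m` vanish.
  have hsc : ∀ {Y : H →L[ℂ] H}, Y ∈ P.tailAlgebra → ∀ {v : H} {i : ℕ},
      (∀ k, k ≠ i → ∀ A, P.ι k A v = A.2 • v) → Y v = inner ℂ (u 0) (Y (u 0)) • v := by
    intro Y hY v i hv
    have := tail_apply hY hv (hu 0)
    rwa [hu0, one_smul] at this
  have hvec : ∀ i : ℕ, ∀ k, k ≠ i → ∀ A, P.ι k A (vec P e (some i)) = A.2 • vec P e (some i) :=
    fun i k hk A => he.ι_vec_of_ne k i hk A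
  have hrest : ∀ k, k ≠ 0 → ∀ A, P.ι k A (rest P e) = A.2 • rest P e := fun k _ A => he.ι_rest k A
  -- The adjoint of `X` is also in the tail, so it is scalar on `rest` and each `vec (some i)`;
  -- hence `X (vec none)` is orthogonal to these vectors.
  have hnone : X (vec P e none) = vacuumState P e X • vec P e none := by
    have hadj : ∀ y : H, inner ℂ y (X (vec P e none)) = inner ℂ ((star X) y) (vec P e none) :=
      fun y => by rw [ContinuousLinearMap.star_eq_adjoint, ContinuousLinearMap.adjoint_inner_left]
    rw [← sub_eq_zero]
    refine he.eq_zero_of_inner (fun m => ?_) ?_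
    · rw [inner_sub_right, inner_smul_right]
      rcases m with _ | i
      · rw [he.inner_vacuum_apply, sub_self]
      · rw [hadj, hsc (star_mem hX) (hvec i), inner_smul_left, he.inner_vec_vec]
        simp
    · rw [inner_sub_right, inner_smul_right, hadj, hsc (star_mem hX) hrest, inner_smul_left,
        he.inner_rest_vec]
      simp
  refine ⟨vacuumState P e X, inner ℂ (u 0) (X (u 0)), he.ext (fun m => ?_) ?_⟩
  · rcases m with _ | i
    · simp [hnone, he.unit_vec]
    · simp [hsc hX (hvec i), he.unit_vec]
  · simp [hsc hX hrest, he.unit_rest]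

theorem vacuum_mem_tailAlgebra : e none none ∈ P.tailAlgebra :=
  StochasticProcess.mem_tailAlgebra fun j => ⟨_, he.unit_none_eq j⟩

/-- The cross terms vanish because `rest` is an eigenvector of both `X` and `star X` and is
orthogonal to `vec none`. -/
theorem vectorState_eq {X : H →L[ℂ] H} (hX : X ∈ P.algebra) :
    P.vectorState X = vacuumState P e X * inner ℂ (vec P e none) (vec P e none) +
      inner ℂ (rest P e) (X (rest P e)) := by
  obtain ⟨c, hc⟩ := he.exists_algebra_apply_rest hX
  obtain ⟨d, hd⟩ := he.exists_algebra_apply_rest (star_mem hX)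
  have h1 : inner ℂ (rest P e) (X (vec P e none)) = 0 := by
    rw [← ContinuousLinearMap.adjoint_inner_left, ← ContinuousLinearMap.star_eq_adjoint, hd,
      inner_smul_left, he.inner_rest_vec, mul_zero]
  have h2 : inner ℂ (vec P e none) (X (rest P e)) = 0 := by
    rw [hc, inner_smul_right, he.inner_vec_rest, mul_zero]
  rw [StochasticProcess.vectorState, ← vec_add_rest (P := P) (e := e), map_add, inner_add_left,
    inner_add_right, inner_add_right, h1, h2, he.inner_vacuum_apply, add_zero, zero_add]

/-- The projection `e_{##} + ∑_{k ∈ K} e_{kk}` commutes with the embeddings labelled by `K`. -/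
theorem commute_sum_unit (K : Finset ℕ) {k : ℕ} (hk : k ∈ K) (A : SampleAlgebra) :
    Commute (P.ι k A) (e none none + ∑ i ∈ K, e (some i) (some i)) := by
  have hl : ∀ m ∈ ({none, some k} : Set (Option ℕ)), ∀ n ∈ ({none, some k} : Set (Option ℕ)),
      Commute (e m n) (e none none + ∑ i ∈ K, e (some i) (some i)) := by
    intro m hm n hn
    have hm' : (e none none + ∑ i ∈ K, e (some i) (some i)) * e m n = e m n := by
      rw [add_mul, Finset.sum_mul]
      rcases hm with rfl | rfl <;> simp [he.mul, hk]
    have hn' : e m n * (e none none + ∑ i ∈ K, e (some i) (some i)) = e m n := by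
      rw [mul_add, Finset.mul_sum]
      rcases hn with rfl | rfl <;> simp [he.mul, hk]
    rw [Commute, SemiconjBy, hm', hn']
  have h00 := hl none (by simp) none (by simp)
  have h11 := hl (some k) (by simp) (some k) (by simp)
  rw [he.ι_eq]
  exact ((((h00.smul_left _).add_left ((hl none (by simp) (some k) (by simp)).smul_left _)).add_left
    ((hl (some k) (by simp) none (by simp)).smul_left _)).add_left (h11.smul_left _)).add_left
    ((((Commute.one_left _).sub_left h00).sub_left h11).smul_left _)

theorem commute_unit_of_ne {i k : ℕ} (h : i ≠ k) (A : SampleAlgebra) :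
    Commute (P.ι i A) (e (some k) (some k)) := by
  rw [Commute, SemiconjBy, he.ι_eq]
  simp [add_mul, mul_add, sub_mul, mul_sub, he.mul, h, h.symm]

theorem commute_of_mem_tailAlgebra {X T : H →L[ℂ] H} (hX : X ∈ P.tailAlgebra)
    (hT : Commute (e none none) T) : Commute X T := by
  obtain ⟨a, c, rfl⟩ := he.exists_tail_eq hX
  exact (hT.smul_left a).add_left (((Commute.one_left T).sub_left hT).smul_left c)

/-- `Y` commutes with `e_## + ∑_{k ∈ K} e_kk`, so it moves the vacuum only into the directions `k ∈
K`. As `X` commutes with each such `e_kk`, it cannot bring those components back to the vacuum. -/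
theorem vacuumState_mul {I K : Finset ℕ} (hIK : Disjoint I K) {X Y : H →L[ℂ] H}
    (hX : X ∈ vonNeumannGen
      ((P.localAlgebra (I : Set ℕ) : Set (H →L[ℂ] H)) ∪ (P.tailAlgebra : Set (H →L[ℂ] H))))
    (hY : Y ∈ vonNeumannGen
      ((P.localAlgebra (K : Set ℕ) : Set (H →L[ℂ] H)) ∪ (P.tailAlgebra : Set (H →L[ℂ] H)))) :
    vacuumState P e (X * Y) = vacuumState P e X * vacuumState P e Y := by
  have hcY : Commute Y (e none none + ∑ i ∈ K, e (some i) (some i)) := by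
    refine StochasticProcess.commute_of_mem_localAlgebra_sup_tail
      (fun k hk A => he.commute_sum_unit K hk A)
      (fun Z hZ => he.commute_of_mem_tailAlgebra hZ ?_) hY
    rw [Commute, SemiconjBy]
    simp [mul_add, add_mul, Finset.mul_sum, Finset.sum_mul, he.mul]
  have hcX : ∀ k ∈ K, Commute X (e (some k) (some k)) := by
    intro k hk
    refine StochasticProcess.commute_of_mem_localAlgebra_sup_tail
      (fun i hi A => he.commute_unit_of_ne (fun h => ?_) A)
      (fun Z hZ => he.commute_of_mem_tailAlgebra hZ ?_) hX
    · exact Finset.disjoint_left.1 hIK hi (h ▸ hk)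
    · rw [Commute, SemiconjBy]
      simp [he.mul]
  have hYv : Y (vec P e none) = vacuumState P e Y • vec P e none +
      ∑ k ∈ K, e (some k) (some k) (Y (vec P e none)) := by
    have := congrArg (fun T : H →L[ℂ] H => T (vec P e none)) hcY.eq
    simpa [he.unit_vec, he.vacuum_apply_apply] using this
  have hXe : ∀ k ∈ K, ∀ y, inner ℂ (vec P e none) (X (e (some k) (some k) y)) = 0 := by
    intro k hk y
    have := congrArg (fun T : H →L[ℂ] H => T y) (hcX k hk).eq
    change X (e (some k) (some k) y) = e (some k) (some k) (X y) at this
    rw [this, ← he.inner_apply_left, he.unit_vec]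
    simp
  have key : inner ℂ (vec P e none) (X (Y (vec P e none))) =
      vacuumState P e Y * inner ℂ (vec P e none) (X (vec P e none)) := by
    rw [hYv, map_add, map_smul, map_sum, inner_add_right, inner_smul_right, inner_sum,
      Finset.sum_eq_zero fun k hk => hXe k hk _, add_zero]
  have hdef : ∀ Z : H →L[ℂ] H, vacuumState P e Z = (inner ℂ (vec P e none) (vec P e none))⁻¹ *
      inner ℂ (vec P e none) (Z (vec P e none)) := fun _ => rfl
  rw [hdef (X * Y), hdef X, mul_apply_eq_comp, key]
  ring

/-! ### Construction of the conditional expectation -/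

theorem inner_vec_tail (a c : ℂ) (x : H) :
    inner ℂ (vec P e none) ((a • e none none + c • (1 - e none none)) x) =
      a * inner ℂ (vec P e none) x := by
  have h : inner ℂ (vec P e none) (e none none x) = inner ℂ (vec P e none) x := by
    rw [← he.inner_apply_left, he.unit_vec, if_pos rfl]
  simp [h]

theorem tail_vec (a c : ℂ) :
    (a • e none none + c • (1 - e none none)) (vec P e none) = a • vec P e none := by
  simp [he.unit_vec]

theorem vacuumState_bimodule (a c a' c' : ℂ) (X : H →L[ℂ] H) :
    vacuumState P e ((a • e none none + c • (1 - e none none)) * X *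
      (a' • e none none + c' • (1 - e none none))) = a * vacuumState P e X * a' := by
  change (inner ℂ (vec P e none) (vec P e none))⁻¹ * inner ℂ (vec P e none)
    ((a • e none none + c • (1 - e none none))
      (X ((a' • e none none + c' • (1 - e none none)) (vec P e none)))) =
    a * ((inner ℂ (vec P e none) (vec P e none))⁻¹ *
      inner ℂ (vec P e none) (X (vec P e none))) * a'
  rw [he.inner_vec_tail, he.tail_vec, map_smul, inner_smul_right]
  ring

/-- The factor `e none none` covers the case `vec none = 0`: the coefficient `a` is then not
recovered, but the projection is zero. -/
theorem vacuumState_smul_vacuum (a c : ℂ) :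
    vacuumState P e (a • e none none + c • (1 - e none none)) • e none none =
      a • e none none := by
  by_cases h : vec P e none = 0
  · have : e none none = 0 := by rw [he.vacuum_eq, h]; simp
    simp [this]
  · congr 1
    change (inner ℂ (vec P e none) (vec P e none))⁻¹ * inner ℂ (vec P e none)
      ((a • e none none + c • (1 - e none none)) (vec P e none)) = a
    rw [he.inner_vec_tail, mul_left_comm, inv_mul_cancel₀ (inner_self_ne_zero.2 h), mul_one]

theorem tail_mul (a c a' c' : ℂ) :
    (a • e none none + c • (1 - e none none)) * (a' • e none none + c' • (1 - e none none)) =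
      (a * a') • e none none + (c * c') • (1 - e none none) := by
  simp only [mul_add, add_mul, mul_sub, sub_mul, smul_mul_assoc, mul_smul_comm, he.mul, mul_one,
    one_mul, if_true]
  module

theorem vectorState_tail (a c : ℂ) :
    P.vectorState (a • e none none + c • (1 - e none none)) =
      a * inner ℂ (vec P e none) (vec P e none) + c * inner ℂ (rest P e) (rest P e) := by
  have h : inner ℂ P.Ω (rest P e) = inner ℂ (rest P e) (rest P e) := by
    rw [← sub_eq_zero, ← inner_sub_left]
    have : P.Ω - rest P e = vec P e none := sub_sub_cancel _ _
    rw [this, he.inner_vec_rest]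
  have h' := he.inner_Ω_vec none
  rw [if_pos rfl] at h'
  rw [← h, ← h', ← inner_smul_right, ← inner_smul_right, ← inner_add_right]
  rfl

/-- The value does not depend on `j`, which is what identical distribution needs. The factors are
left uncancelled so that the formula covers `vec none = 0`. -/
theorem vacuumState_ι (j : ℕ) (A : SampleAlgebra) :
    vacuumState P e (P.ι j A) = (inner ℂ (vec P e none) (vec P e none))⁻¹ *
      (A.1 0 0 * inner ℂ (vec P e none) (vec P e none)) := by
  change (inner ℂ (vec P e none) (vec P e none))⁻¹ *
    inner ℂ (vec P e none) (P.ι j A (vec P e none)) = _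
  rw [he.ι_vec_none, inner_add_right, inner_smul_right, inner_smul_right,
    he.inner_vec_vec none (some j)]
  simp

/-- A state which is multiplicative on the tail algebra, equal to the character `A ↦ A.2` on all the
embedded algebras, and given by the vector `rest P e` if that does not vanish. -/
theorem exists_restState : ∃ ψ : (H →L[ℂ] H) →ₗ[ℂ] ℂ,
    (∀ X : H →L[ℂ] H, X.IsPositive → 0 ≤ ψ X) ∧
    (∀ (a c a' c' : ℂ) (X : H →L[ℂ] H), ψ ((a • e none none + c • (1 - e none none)) * X *
      (a' • e none none + c' • (1 - e none none))) = c * ψ X * c') ∧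
    ψ 1 = 1 ∧ (∀ j A, ψ (P.ι j A) = A.2) ∧
    ∀ X ∈ P.algebra, X (rest P e) = ψ X • rest P e := by
  obtain ⟨u, hu1, hu, hu0, hur⟩ := he.exists_unit_vectors
  obtain ⟨ψ, hψ⟩ := exists_limit_vectorState u hu1
  have hinner : ∀ i, inner ℂ (u i) (u i) = (1 : ℂ) := fun i => by
    rw [inner_self_eq_norm_sq_to_K, hu1]; simp
  have hconst : ∀ (X : H →L[ℂ] H) (c : ℂ), (∀ i, X (u i) = c • u i) → ψ X = c := by
    intro X c h
    refine tendsto_nhds_unique (hψ X) (tendsto_const_nhds.congr fun i => ?_)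
    rw [h, inner_smul_right, hinner, mul_one]
  refine ⟨ψ, fun X hX => ?_, fun a c a' c' X => ?_, hconst 1 1 fun i => by simp, fun j A => ?_,
    fun X hX => ?_⟩
  · exact ge_of_tendsto' (hψ X) fun i => hX.inner_nonneg_right (u i)
  -- Each `u i` is killed by `e none none`, so the factors on either side contribute only `c` and
  -- `c'`, before and hence after the limit.
  · refine tendsto_nhds_unique (hψ _) ((((hψ X).const_mul c).mul_const c').congr fun i => ?_)
    have h1 : (a' • e none none + c' • (1 - e none none)) (u i) = c' • u i := by
      simp [hu0]
    have h2 : ∀ x, inner ℂ (u i) ((a • e none none + c • (1 - e none none)) x) =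
        c * inner ℂ (u i) x := by
      intro x
      have : inner ℂ (u i) (e none none x) = 0 := by
        rw [← he.inner_apply_left, hu0, inner_zero_left]
      simp [this]
    rw [mul_apply_eq_comp, mul_apply_eq_comp, h1, h2, map_smul, inner_smul_right]
    ring
  · refine tendsto_nhds_unique (hψ _) (tendsto_const_nhds.congr' ?_)
    -- The ultrafilter is free, so the one index at which `ι j` need not act by the character is
    -- negligible.
    have : ∀ᶠ i in Filter.cofinite, i ≠ j := (Set.finite_singleton j).eventually_cofinite_notMem
    filter_upwards [Filter.hyperfilter_le_cofinite this] with i hi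
    rw [hu i j hi.symm, inner_smul_right, hinner, mul_one]
  · rcases hur with h | ⟨c, hc⟩
    · simp [h]
    · obtain ⟨d, hd⟩ := he.exists_algebra_apply_rest hX
      rw [hconst X d fun i => by rw [hc, map_smul, hd, smul_comm], hd]

theorem isConditionallyIID : P.IsConditionallyIID := by
  obtain ⟨ψ, hpos, hbi, hone, hι, hrest⟩ := he.exists_restState
  let p : P.tailAlgebra := ⟨e none none, he.vacuum_mem_tailAlgebra⟩
  let s : P.algebra →ₗ[ℂ] (H →L[ℂ] H) := P.algebra.subtype.toAlgHom.toLinearMap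
  let E : P.algebra →ₗ[ℂ] P.tailAlgebra :=
    ((vacuumState P e).comp s).smulRight p + (ψ.comp s).smulRight (1 - p)
  have hE : ∀ X : P.algebra, (E X : H →L[ℂ] H) =
      vacuumState P e X • e none none + ψ X • (1 - e none none) := fun _ => rfl
  have hproj := he.isStarProjection none
  refine ⟨E, ⟨fun X hX => ?_, fun n => ?_, fun m n X => ?_⟩, fun X => ?_,
    fun I K hIK X Y hX hY => ?_, fun i k A => ?_⟩
  · have h0 : 0 ≤ vacuumState P e X := by
      rw [vacuumState_apply]
      exact mul_nonneg (inv_nonneg.2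
        (ContinuousLinearMap.isPositive_one.inner_nonneg_right _)) (hX.inner_nonneg_right _)
    rw [hE]
    exact ((ContinuousLinearMap.IsPositive.of_isStarProjection hproj).smul_of_nonneg h0).add
      ((ContinuousLinearMap.IsPositive.of_isStarProjection hproj.one_sub).smul_of_nonneg
        (hpos X hX))
  · apply Subtype.ext
    obtain ⟨a, c, hn⟩ := he.exists_tail_eq n.2
    rw [hE]
    change vacuumState P e n • e none none + ψ n • (1 - e none none) = n
    -- With `X = 1` and trivial right factor, the bimodule rule reads off `ψ n = c`.
    have hψ := hbi a c 1 1 1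
    rw [mul_one, one_smul, one_smul, add_sub_cancel, mul_one, hone, mul_one, mul_one] at hψ
    rw [hn, he.vacuumState_smul_vacuum, hψ]
  · apply Subtype.ext
    obtain ⟨a, c, hm⟩ := he.exists_tail_eq m.2
    obtain ⟨a', c', hn⟩ := he.exists_tail_eq n.2
    change (E _ : H →L[ℂ] H) = m * E X * n
    rw [hE, hE]
    change vacuumState P e (m * X * n) • e none none + ψ (m * X * n) • (1 - e none none) = _
    rw [hm, hn, he.vacuumState_bimodule, hbi, he.tail_mul, he.tail_mul]
  · rw [hE, he.vectorState_tail, he.vectorState_eq X.2, hrest X X.2, inner_smul_right]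
  -- Both sides equal `φ(X) φ(Y) ‖vec none‖² + ψ(X) ψ(Y) ‖rest‖²`. The second term needs no
  -- multiplicativity of `ψ`, only the eigenvector equation for `rest`.
  · rw [hE, hE, he.tail_mul, he.vectorState_tail, he.vectorState_eq (mul_mem X.2 Y.2),
      he.vacuumState_mul hIK hX hY, mul_apply_eq_comp, hrest Y Y.2, map_smul, hrest X X.2,
      inner_smul_right, inner_smul_right]
    ring
  · apply Subtype.ext
    rw [hE, hE]
    simp only [he.vacuumState_ι, hι]

end IsVacuumProcess

end BooleanDeFinetti

end

theorem mainTheorem1 {H : Type*} [NormedAddCommGroup H] [InnerProductSpace ℂ H] [CompleteSpace H]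
    (ω : BooleanDeFinetti.booleanAlgebra →ₗ[ℂ] ℂ) (hω : BooleanDeFinetti.IsState ω)
    (P : BooleanDeFinetti.StochasticProcess BooleanDeFinetti.SampleAlgebra ℕ H)
    (hP : BooleanDeFinetti.IsBooleanProcess ω P) :
    P.IsExchangeable ↔ P.IsConditionallyIID := by
  obtain ⟨e, he⟩ := hP.exists_isMatrixUnitProcess
  constructor
  · intro h
    exact BooleanDeFinetti.IsVacuumProcess.isConditionallyIID
      ⟨he, he.unit_apply_Ω_eq_zero_of_isExchangeable h⟩
  · intro h
    exact BooleanDeFinetti.IsVacuumProcess.isExchangeable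
      ⟨he, he.unit_apply_Ω_eq_zero_of_isConditionallyIID h⟩
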